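/- Let $q$ be a complex number with $|q|<1$ and let $m\ge 0$ be an integer; if $m\ge 2$ assume $q\neq 0$. Write $(a;q)_n=\prod_{k=0}^{n-1}(1-aq^k)$, $(a;q)_\infty=\prod_{k=0}^{\infty}(1-aq^k)$, $(a,b,c;q)_\infty=(a;q)_\infty(b;q)_\infty(c;q)_\infty$, and, for integers $n,k$, $$\begin{bmatrix} n\\ k\end{bmatrix}_{q}=\begin{cases}\dfrac{(q;q)_n}{(q;q)_k(q;q)_{n-k}}, & 0\le k\le n,\\ 0,&\text{otherwise.}\end{cases}$$ Set $a_0(q)=0$, $b_0(q)=1$, and for $m\ge 1$ (sums over all integers $n,j$, only finitely many terms being nonzero) $$a_m(q)=\sum_{n,j}(-1)^jq^{n^2}\begin{bmatrix} m-1-n+j\\ j\end{bmatrix}_{q^2}\begin{bmatrix} m-1-j\\ n-j\end{bmatrix}_{q^2},\qquad b_m(q)=\sum_{n,j}(-1)^jq^{n^2+2n}\begin{bmatrix} m-2-n+j\\ j\end{bmatrix}_{q^2}\begin{bmatrix} m-2-j\\ n-j\end{bmatrix}_{q^2}.$$ Then the series below converges absolutely and $$\sum_{n=0}^{\infty}\frac{q^{n^2+2mn}}{(q;q^2)_{m+n}(q^2;q^2)_n}=\frac{(-1)^{m-1}(-q;q^2)_\infty}{q^{2m(m-1)}(q^2;q^2)_\infty}\Big[a_m(q)\,(q^4,q^{16},q^{20};q^{20})_\infty-b_m(q)\,(q^8,q^{12},q^{20};q^{20})_\infty\Big].$$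 -/

import Mathlib

/-- The finite `q`-shifted factorial `(a; q)_n = ∏_{k < n} (1 - a q^k)`. -/
noncomputable def qPoch (a q : ℂ) (n : ℕ) : ℂ :=
  ∏ k ∈ Finset.range n, (1 - a * q ^ k)

/-- The infinite `q`-shifted factorial `(a; q)_∞ = ∏_{k ≥ 0} (1 - a q^k)`. -/
noncomputable def qPochInf (a q : ℂ) : ℂ :=
  ∏' k : ℕ, (1 - a * q ^ k)

/-- The product defining `(a; q)_∞` converges whenever `|q| < 1`. -/
theorem multipliable_qPochInf (a q : ℂ) (hq : ‖q‖ < 1) :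
    Multipliable (fun k : ℕ => 1 - a * q ^ k) := by
  have h : Summable (fun k : ℕ => ‖-(a * q ^ k)‖) := by
    simp only [norm_neg, norm_mul, norm_pow]
    exact (summable_geometric_of_lt_one (norm_nonneg q) hq).mul_left _
  simpa [sub_eq_add_neg] using multipliable_one_add_of_summable h

/-- The multi-parameter symbol `(a, b, c; q)_∞ = (a; q)_∞ (b; q)_∞ (c; q)_∞`. -/
noncomputable def qPochInf₃ (a b c q : ℂ) : ℂ :=
  qPochInf a q * qPochInf b q * qPochInf c q

/-- The Gaussian polynomial with base `q` (for `|q| < 1`): it is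
`(q; q)_n / ((q; q)_k (q; q)_{n-k})` if `0 ≤ k ≤ n`, and `0` for all other integers `n`, `k`. -/
noncomputable def gaussPoly (q : ℂ) (n k : ℤ) : ℂ :=
  if 0 ≤ k ∧ k ≤ n then
    qPoch q q n.toNat / (qPoch q q k.toNat * qPoch q q (n - k).toNat)
  else 0

/-- The product of Gaussian polynomials below vanishes outside `0 ≤ j ≤ n ≤ M`; hence the sums over
all integers `n`, `j` in the next two definitions are sums over `0 ≤ n, j ≤ M`. -/
theorem gaussPoly_mul_eq_zero (q : ℂ) (M n j : ℤ) (h : ¬ (0 ≤ j ∧ j ≤ n ∧ n ≤ M)) :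
    gaussPoly q (M - n + j) j * gaussPoly q (M - j) (n - j) = 0 := by
  unfold gaussPoly
  split_ifs with h₁ h₂
  · exact absurd ⟨h₁.1, by omega, by omega⟩ h
  all_goals simp

/-- `a_0 = 0`, and for `m ≥ 1`
`a_m(q) = ∑_{n,j} (-1)^j q^{n²} [m-1-n+j, j]_{q²} [m-1-j, n-j]_{q²}`
(the terms with `n ≥ m` or `j ≥ m` are zero). -/
noncomputable def aPoly (m : ℕ) (q : ℂ) : ℂ :=
  if m = 0 then 0
  else ∑ n ∈ Finset.range m, ∑ j ∈ Finset.range m,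
    q ^ (n ^ 2) * (-1) ^ j * gaussPoly (q ^ 2) ((m : ℤ) - 1 - n + j) j *
      gaussPoly (q ^ 2) ((m : ℤ) - 1 - j) ((n : ℤ) - j)

/-- `b_0 = 1`, and for `m ≥ 1`
`b_m(q) = ∑_{n,j} (-1)^j q^{n²+2n} [m-2-n+j, j]_{q²} [m-2-j, n-j]_{q²}`
(the terms with `n ≥ m - 1` or `j ≥ m - 1` are zero). -/
noncomputable def bPoly (m : ℕ) (q : ℂ) : ℂ :=
  if m = 0 then 1
  else ∑ n ∈ Finset.range m, ∑ j ∈ Finset.range m,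
    q ^ (n ^ 2 + 2 * n) * (-1) ^ j * gaussPoly (q ^ 2) ((m : ℤ) - 2 - n + j) j *
      gaussPoly (q ^ 2) ((m : ℤ) - 2 - j) ((n : ℤ) - j)

/-! Put `Q = q^4` and let `S_m` be the series. Termwise telescoping gives `S_m = S_{m+1} + Q^{m+1}
S_{m+2}` (`slaterSum_eq`), and Selberg's alternating series `V_m` satisfies the same recurrence
(`selbergV_eq`). Both have limits as `m → ∞`, and a solution tending to zero is zero, so `S_m` is a
constant multiple of `V_m` (`slaterSum_eq_selbergV`). At `m = 0, 1` the quotient of factorials in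
`V_m` disappears and Jacobi's triple product evaluates the series: these are the two infinite
products of base `q^20`.

Solving the recurrence for `S_{m+2}` expresses every `S_m` through `S_0` and `S_1`. After
multiplication by `q^{2m(m-1)}` and removal of the sign, the coefficients obey `x_{m+2} = x_{m+1} +
q^{4m} x_m`. The polynomials `a_m`, `b_m` obey it too, because their inner sums over `j` are
coefficients of `1/(x;p)_{N+1} · 1/(-x;p)_{N+1} = 1/(x²;p²)_{N+1}` with `p = q²`
(`altConvSum_add_two`). -/

open Filter Topology

/-! ### Shifted factorials: nonvanishing, limits, uniform bounds -/

theorem qPoch_zero (a q : ℂ) : qPoch a q 0 = 1 := by simp [qPoch]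

theorem qPoch_succ (a q : ℂ) (n : ℕ) : qPoch a q (n + 1) = qPoch a q n * (1 - a * q ^ n) := by
  simp [qPoch, Finset.prod_range_succ]

theorem qPoch_self_succ (q : ℂ) (n : ℕ) :
    qPoch q q (n + 1) = qPoch q q n * (1 - q ^ (n + 1)) := by
  rw [qPoch_succ, pow_succ']

theorem one_sub_pow_ne_zero {q : ℂ} (hq : ‖q‖ < 1) {n : ℕ} (hn : n ≠ 0) : 1 - q ^ n ≠ 0 := by
  intro h
  have h1 : ‖q ^ n‖ < 1 := by
    rw [norm_pow]
    exact pow_lt_one₀ (norm_nonneg _) hq hn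
  rw [← sub_eq_zero.mp h] at h1
  simp at h1

theorem qPoch_ne_zero {a q : ℂ} (h : ∀ k : ℕ, 1 - a * q ^ k ≠ 0) (n : ℕ) : qPoch a q n ≠ 0 :=
  Finset.prod_ne_zero_iff.mpr fun k _ => h k

theorem qPoch_self_ne_zero {q : ℂ} (hq : ‖q‖ < 1) (n : ℕ) : qPoch q q n ≠ 0 :=
  qPoch_ne_zero (fun k => by rw [← pow_succ']; exact one_sub_pow_ne_zero hq k.succ_ne_zero) n

theorem tendsto_qPoch (a : ℂ) {q : ℂ} (hq : ‖q‖ < 1) :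
    Tendsto (qPoch a q) atTop (𝓝 (qPochInf a q)) :=
  (multipliable_qPochInf a q hq).hasProd.tendsto_prod_nat

theorem qPochInf_ne_zero {a q : ℂ} (hq : ‖q‖ < 1) (h : ∀ k : ℕ, 1 - a * q ^ k ≠ 0) :
    qPochInf a q ≠ 0 := by
  have hs : Summable (fun k : ℕ => ‖-(a * q ^ k)‖) := by
    simp only [norm_neg, norm_mul, norm_pow]
    exact (summable_geometric_of_lt_one (norm_nonneg q) hq).mul_left _
  have := tprod_one_add_ne_zero_of_summable (f := fun k : ℕ => -(a * q ^ k))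
    (fun k => by simpa [sub_eq_add_neg] using h k) hs
  simpa [qPochInf, sub_eq_add_neg] using this

theorem qPochInf_self_ne_zero {q : ℂ} (hq : ‖q‖ < 1) : qPochInf q q ≠ 0 :=
  qPochInf_ne_zero hq fun k => by
    rw [← pow_succ']; exact one_sub_pow_ne_zero hq k.succ_ne_zero

theorem exists_norm_le_of_tendsto {u : ℕ → ℂ} {l : ℂ} (h : Tendsto u atTop (𝓝 l)) :
    ∃ C : ℝ, 0 < C ∧ ∀ n, ‖u n‖ ≤ C := by
  obtain ⟨C, hC⟩ := (Metric.isBounded_range_of_tendsto u h).exists_pos_norm_le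
  exact ⟨C, hC.1, fun n => hC.2 _ ⟨n, rfl⟩⟩

theorem exists_norm_qPoch_le (a : ℂ) {q : ℂ} (hq : ‖q‖ < 1) :
    ∃ C : ℝ, 0 < C ∧ ∀ n, ‖qPoch a q n‖ ≤ C :=
  exists_norm_le_of_tendsto (tendsto_qPoch a hq)

theorem exists_norm_qPoch_inv_le {a q : ℂ} (hq : ‖q‖ < 1) (h : ∀ k : ℕ, 1 - a * q ^ k ≠ 0) :
    ∃ C : ℝ, 0 < C ∧ ∀ n, ‖(qPoch a q n)⁻¹‖ ≤ C :=
  exists_norm_le_of_tendsto ((tendsto_qPoch a hq).inv₀ (qPochInf_ne_zero hq h))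

theorem exists_norm_qPoch_self_inv_le {q : ℂ} (hq : ‖q‖ < 1) :
    ∃ C : ℝ, 0 < C ∧ ∀ n, ‖(qPoch q q n)⁻¹‖ ≤ C :=
  exists_norm_qPoch_inv_le hq fun k => by
    rw [← pow_succ']; exact one_sub_pow_ne_zero hq k.succ_ne_zero

/-- Factors `1 - q^{2k}` with `k` odd split as a difference of squares; those with `k` even have
base `q^4`. -/
theorem qPoch_sq_two_mul (q : ℂ) (n : ℕ) :
    qPoch (q ^ 2) (q ^ 2) (2 * n) =
      qPoch (-q) (q ^ 2) n * qPoch q (q ^ 2) n * qPoch (q ^ 4) (q ^ 4) n := by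
  induction n with
  | zero => simp [qPoch]
  | succ n ih =>
    rw [show 2 * (n + 1) = 2 * n + 1 + 1 by ring]
    simp only [qPoch_succ]
    rw [ih]
    ring

theorem qPochInf_sq {q : ℂ} (hq : ‖q‖ < 1) :
    qPochInf (q ^ 2) (q ^ 2) =
      qPochInf (-q) (q ^ 2) * qPochInf q (q ^ 2) * qPochInf (q ^ 4) (q ^ 4) := by
  have h2 : ‖q ^ 2‖ < 1 := by rw [norm_pow]; exact pow_lt_one₀ (norm_nonneg _) hq (by norm_num)
  have h4 : ‖q ^ 4‖ < 1 := by rw [norm_pow]; exact pow_lt_one₀ (norm_nonneg _) hq (by norm_num)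
  refine tendsto_nhds_unique
    ((tendsto_qPoch (q ^ 2) h2).comp (tendsto_id.const_mul_atTop' (two_pos : (0 : ℕ) < 2))) ?_
  refine (((tendsto_qPoch (-q) h2).mul (tendsto_qPoch q h2)).mul (tendsto_qPoch (q ^ 4) h4)).congr
    fun n => ?_
  exact (qPoch_sq_two_mul q n).symm

/-! ### Uniqueness for the three-term recurrence, and telescoping sums -/

/-- A solution of `d_m = d_{m+1} + Q^{m+1} d_{m+2}` that tends to zero vanishes. -/
theorem eq_zero_of_recurrence_of_tendsto_zero {Q : ℂ} (hQ : ‖Q‖ < 1) {d : ℕ → ℂ}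
    (hd : ∀ m, d m = d (m + 1) + Q ^ (m + 1) * d (m + 2)) (h0 : Tendsto d atTop (𝓝 0)) (m : ℕ) :
    d m = 0 := by
  set r := ‖Q‖ with hr
  have hr0 : 0 ≤ r := norm_nonneg Q
  -- Weights chosen so that a bound on `‖d k‖ * P k` passes from `k + 1` and `k + 2` down to `k`
  -- without loss; they are `(-r; r)_k`, hence bounded.
  set P : ℕ → ℝ := fun k => ∏ j ∈ Finset.range k, (1 + r ^ (j + 1)) with hP
  have hPs : ∀ k, P (k + 1) = P k * (1 + r ^ (k + 1)) := fun k => Finset.prod_range_succ _ _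
  have hP1 : ∀ k, 1 ≤ P k := fun k => by
    induction k with
    | zero => simp [hP]
    | succ k ih =>
      rw [hPs]
      nlinarith [pow_nonneg hr0 (k + 1)]
  have hPmono : ∀ k, P k ≤ P (k + 1) := fun k => by
    rw [hPs]
    have := pow_nonneg hr0 (k + 1)
    nlinarith [hP1 k]
  obtain ⟨C, hC0, hC⟩ : ∃ C : ℝ, 0 < C ∧ ∀ k, P k ≤ C := by
    obtain ⟨C, hC0, hC⟩ := exists_norm_qPoch_le (-(r : ℂ)) (q := (r : ℂ)) (by simpa [r] using hQ)
    refine ⟨C, hC0, fun k => ?_⟩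
    have h1 : qPoch (-(r : ℂ)) r k = ((P k : ℝ) : ℂ) := by
      simp only [qPoch, hP]
      push_cast
      exact Finset.prod_congr rfl fun j _ => by ring
    have h2 := hC k
    rw [h1, Complex.norm_real] at h2
    exact (le_abs_self _).trans h2
  have key : ∀ ε > 0, ‖d m‖ ≤ ε * C := by
    intro ε hε
    obtain ⟨N, hN⟩ := (Metric.tendsto_atTop.mp h0) ε hε
    -- Backward induction from the tail: `i` bounds how far `k` lies below `N`.
    have step : ∀ i k, N ≤ k + i → ‖d k‖ * P k ≤ ε * C := by
      intro i
      induction i with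
      | zero =>
        intro k hk
        have := hN k hk
        rw [dist_zero_right] at this
        exact mul_le_mul this.le (hC k) (by linarith [hP1 k]) hε.le
      | succ i ih =>
        intro k hk
        have h1 := ih (k + 1) (by omega)
        have h2 := ih (k + 2) (by omega)
        have h3 : ‖d (k + 2)‖ * P (k + 1) ≤ ε * C :=
          (mul_le_mul_of_nonneg_left (hPmono _) (norm_nonneg _)).trans h2
        have h4 : ‖d k‖ ≤ ‖d (k + 1)‖ + r ^ (k + 1) * ‖d (k + 2)‖ := by
          conv_lhs => rw [hd k]
          refine (norm_add_le _ _).trans ?_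
          rw [norm_mul, norm_pow]
        have hpos := pow_nonneg hr0 (k + 1)
        have h5 : ‖d k‖ * P (k + 1) ≤ (1 + r ^ (k + 1)) * (ε * C) := by
          have := mul_le_mul_of_nonneg_right h4 (zero_le_one.trans (hP1 (k + 1)))
          have := mul_le_mul_of_nonneg_left h3 hpos
          nlinarith
        rw [hPs] at h5
        refine le_of_mul_le_mul_left ?_ (show 0 < 1 + r ^ (k + 1) by linarith)
        linarith
    have := step N m (by omega)
    nlinarith [hP1 m, norm_nonneg (d m)]
  rw [← norm_le_zero_iff]
  refine le_of_forall_pos_le_add fun ε hε => ?_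
  have := key (ε / C) (by positivity)
  rwa [div_mul_cancel₀ _ hC0.ne', ← zero_add ε] at this

theorem tsum_eq_of_telescoping {f g h E : ℕ → ℂ} {c : ℂ}
    (hf : ∀ n, f n = g n + c * h n + (E n - E (n + 1))) (hE0 : E 0 = 0)
    (hg : Summable g) (hh : Summable h) (hE : Summable E) :
    ∑' n, f n = ∑' n, g n + c * ∑' n, h n := by
  have hE1 : Summable fun n => E (n + 1) := (summable_nat_add_iff 1).mpr hE
  rw [tsum_congr hf, (hg.add (hh.mul_left c)).tsum_add (hE.sub hE1),
    hg.tsum_add (hh.mul_left c), hE.tsum_sub hE1, tsum_mul_left, hE.tsum_eq_zero_add, hE0]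
  ring

theorem summable_of_norm_le_geometric {f : ℕ → ℂ} {C r : ℝ} (hr0 : 0 ≤ r) (hr : r < 1)
    (h : ∀ n, ‖f n‖ ≤ C * r ^ n) : Summable f :=
  Summable.of_norm_bounded ((summable_geometric_of_lt_one hr0 hr).mul_left C) h

/-- Triangular numbers as binomial coefficients. -/
theorem choose_two_succ (n : ℕ) : (n + 1 + 1).choose 2 = (n + 1).choose 2 + (n + 1) := by
  rw [Nat.choose_succ_succ' (n + 1) 1, Nat.choose_one_right, add_comm]

theorem norm_one_sub_pow_le {Q : ℂ} (hQ : ‖Q‖ < 1) (n : ℕ) : ‖1 - Q ^ n‖ ≤ 2 := by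
  refine (norm_sub_le _ _).trans ?_
  have : ‖Q ^ n‖ ≤ 1 := by rw [norm_pow]; exact pow_le_one₀ (norm_nonneg _) hQ.le
  rw [norm_one]
  linarith

/-! ### Selberg's series and its recurrence -/

/-- The common shape of the terms of the Rogers–Selberg type series. -/
noncomputable def selbergTerm (Q : ℂ) (m n e k : ℕ) : ℂ :=
  (-1) ^ n * Q ^ e * (1 - Q ^ k) * (qPoch Q Q (m + n) / qPoch Q Q n)

theorem exists_norm_selbergTerm_le {Q : ℂ} (hQ : ‖Q‖ < 1) :
    ∃ C : ℝ, 0 < C ∧ ∀ m n e k d, d ≤ e → ‖selbergTerm Q m n e k‖ ≤ C * ‖Q‖ ^ d := by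
  obtain ⟨A, hA0, hA⟩ := exists_norm_qPoch_le Q hQ
  obtain ⟨B, hB0, hB⟩ := exists_norm_qPoch_self_inv_le hQ
  refine ⟨2 * (A * B), by positivity, fun m n e k d hd => ?_⟩
  rw [selbergTerm, div_eq_mul_inv, norm_mul, norm_mul, norm_mul, norm_mul, norm_pow, norm_neg,
    norm_one, one_pow, one_mul, norm_pow]
  calc ‖Q‖ ^ e * ‖1 - Q ^ k‖ * (‖qPoch Q Q (m + n)‖ * ‖(qPoch Q Q n)⁻¹‖)
      ≤ ‖Q‖ ^ d * 2 * (A * B) := by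
        gcongr ?_ * ?_ * (?_ * ?_)
        · exact pow_le_pow_of_le_one (norm_nonneg _) hQ.le hd
        · exact norm_one_sub_pow_le hQ k
        · exact hA _
        · exact hB _
    _ = _ := by ring

theorem summable_selbergTerm {Q : ℂ} (hQ : ‖Q‖ < 1) (m : ℕ) {e k : ℕ → ℕ} (he : ∀ n, n ≤ e n) :
    Summable fun n => selbergTerm Q m n (e n) (k n) := by
  obtain ⟨C, -, hC⟩ := exists_norm_selbergTerm_le hQ
  exact summable_of_norm_le_geometric (norm_nonneg Q) hQ fun n => hC _ _ _ _ _ (he n)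

/-- Up to the factor `(Q; Q)_∞`, Selberg's function `J_{2,2}(Q^m)`. -/
noncomputable def selbergV (Q : ℂ) (m : ℕ) : ℂ :=
  ∑' n : ℕ, selbergTerm Q m n (2 * m * n + (n + 1).choose 2 + 2 * n ^ 2) (2 * m + 4 * n + 2)

/-- Up to the factor `(Q; Q)_∞`, Selberg's function `J_{2,1}(Q^m)`. -/
noncomputable def selbergW (Q : ℂ) (m : ℕ) : ℂ :=
  ∑' n : ℕ, selbergTerm Q m n (2 * m * n + (n + 1).choose 2 + 2 * n ^ 2 + n) (m + 2 * n + 1)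

theorem le_two_mul_sq (n : ℕ) : n ≤ 2 * n ^ 2 := by nlinarith [Nat.le_self_pow two_ne_zero n]

/-- Split `1 - Q^{m+2n+1} = (1 - Q^n) + Q^n (1 - Q^{m+n+1})`: the first part is `E n`, and the
second recombines with `E (n+1)` into the term at `m + 1`. -/
theorem selbergW_eq {Q : ℂ} (hQ : ‖Q‖ < 1) (m : ℕ) : selbergW Q m = selbergV Q (m + 1) := by
  have key := tsum_eq_of_telescoping
    (f := fun n => selbergTerm Q m n (2 * m * n + (n + 1).choose 2 + 2 * n ^ 2 + n) (m + 2 * n + 1))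
    (g := fun n => selbergTerm Q (m + 1) n
      (2 * (m + 1) * n + (n + 1).choose 2 + 2 * n ^ 2) (2 * (m + 1) + 4 * n + 2))
    (h := fun _ => 0) (c := 0)
    (E := fun n => selbergTerm Q m n (2 * m * n + (n + 1).choose 2 + 2 * n ^ 2 + n) n)
    ?_ ?_ ?_ summable_zero ?_
  · simpa [selbergV, selbergW] using key
  · intro n
    have h0 := qPoch_self_ne_zero hQ n
    have h1 := one_sub_pow_ne_zero hQ n.succ_ne_zero
    simp only [selbergTerm, choose_two_succ]
    rw [show m + (n + 1) = m + n + 1 by ring, show m + 1 + n = m + n + 1 by ring,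
      qPoch_self_succ, qPoch_self_succ]
    rw [Nat.succ_eq_add_one] at h1
    field_simp
    ring
  · simp [selbergTerm]
  · exact summable_selbergTerm hQ _ fun n => by have := le_two_mul_sq n; omega
  · exact summable_selbergTerm hQ _ fun n => by omega

theorem selbergV_eq {Q : ℂ} (hQ : ‖Q‖ < 1) (m : ℕ) :
    selbergV Q m = selbergV Q (m + 1) + Q ^ (m + 1) * selbergV Q (m + 2) := by
  -- In terms of `selbergW` the relation telescopes, since `1 - Q^{2m+4n+2} - Q^n (1 - Q^{m+2n+1}) =
  -- (1 - Q^n) + Q^{m+3n+1} (1 - Q^{m+n+1})`.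
  rw [← selbergW_eq hQ m, ← selbergW_eq hQ (m + 1)]
  refine tsum_eq_of_telescoping
    (E := fun n => selbergTerm Q m n (2 * m * n + (n + 1).choose 2 + 2 * n ^ 2) n) ?_ ?_ ?_ ?_ ?_
  · intro n
    have h0 := qPoch_self_ne_zero hQ n
    have h1 := one_sub_pow_ne_zero hQ n.succ_ne_zero
    simp only [selbergTerm, choose_two_succ]
    rw [show m + (n + 1) = m + n + 1 by ring, show m + 1 + n = m + n + 1 by ring,
      qPoch_self_succ, qPoch_self_succ]
    rw [Nat.succ_eq_add_one] at h1
    field_simp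
    ring
  · simp [selbergTerm]
  · exact summable_selbergTerm hQ _ fun n => by omega
  · exact summable_selbergTerm hQ _ fun n => by omega
  · exact summable_selbergTerm hQ _ fun n => by have := le_two_mul_sq n; omega

/-- Terms with `n ≥ 1` carry `Q^{2mn}` and die; dominated convergence leaves only `n = 0`. -/
theorem tendsto_selbergV {Q : ℂ} (hQ : ‖Q‖ < 1) :
    Tendsto (selbergV Q) atTop (𝓝 (qPochInf Q Q)) := by
  obtain ⟨C, hC0, hC⟩ := exists_norm_selbergTerm_le hQ
  have hlim := tendsto_tsum_of_dominated_convergence (𝓕 := (atTop : Filter ℕ))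
    (f := fun m n => selbergTerm Q m n (2 * m * n + (n + 1).choose 2 + 2 * n ^ 2)
      (2 * m + 4 * n + 2))
    (g := fun n => if n = 0 then qPochInf Q Q else 0) (bound := fun n => C * ‖Q‖ ^ n)
    ((summable_geometric_of_lt_one (norm_nonneg Q) hQ).mul_left C) ?_ ?_
  · rw [tsum_ite_eq] at hlim
    exact hlim
  · intro n
    rcases Nat.eq_zero_or_pos n with rfl | hn
    · have h1 : Tendsto (fun m : ℕ => Q ^ (2 * m + 2)) atTop (𝓝 0) :=
        (tendsto_pow_atTop_nhds_zero_of_norm_lt_one hQ).comp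
          (tendsto_atTop_mono (fun m => by simp only [id]; omega) tendsto_id)
      have := (h1.const_sub 1).mul (tendsto_qPoch Q hQ)
      simpa [selbergTerm, qPoch_zero] using this
    · rw [if_neg hn.ne']
      refine squeeze_zero_norm (a := fun m => C * ‖Q‖ ^ m) (fun m => hC _ _ _ _ _ ?_) ?_
      · nlinarith [Nat.zero_le ((n + 1).choose 2)]
      · simpa using (tendsto_pow_atTop_nhds_zero_of_lt_one (norm_nonneg Q) hQ).const_mul C
  · refine Eventually.of_forall fun m n => hC _ _ _ _ _ ?_
    have := le_two_mul_sq n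
    omega

theorem norm_pow_lt_one {q : ℂ} (hq : ‖q‖ < 1) {n : ℕ} (hn : n ≠ 0) : ‖q ^ n‖ < 1 := by
  rw [norm_pow]; exact pow_lt_one₀ (norm_nonneg _) hq hn

theorem one_sub_mul_sq_pow_ne_zero {q : ℂ} (hq : ‖q‖ < 1) (k : ℕ) : 1 - q * (q ^ 2) ^ k ≠ 0 := by
  rw [← pow_mul, ← pow_succ']
  exact one_sub_pow_ne_zero hq (Nat.succ_ne_zero _)

/-! ### The series to be evaluated, as a multiple of Selberg's -/

/-- The terms of the series to be evaluated. -/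
noncomputable def slaterTerm (q : ℂ) (m n : ℕ) : ℂ :=
  q ^ (n ^ 2 + 2 * m * n) / (qPoch q (q ^ 2) (m + n) * qPoch (q ^ 2) (q ^ 2) n)

theorem exists_norm_slaterTerm_le {q : ℂ} (hq : ‖q‖ < 1) :
    ∃ C : ℝ, 0 < C ∧ ∀ m k n e d, d ≤ e →
      ‖q ^ e / (qPoch q (q ^ 2) m * qPoch (q ^ 2) (q ^ 2) n) * (1 - q ^ k)‖ ≤ C * ‖q‖ ^ d ∧
      ‖q ^ e / (qPoch q (q ^ 2) m * qPoch (q ^ 2) (q ^ 2) n)‖ ≤ C * ‖q‖ ^ d := by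
  have h2 := norm_pow_lt_one hq two_ne_zero
  obtain ⟨A, hA0, hA⟩ := exists_norm_qPoch_inv_le h2 (one_sub_mul_sq_pow_ne_zero hq)
  obtain ⟨B, hB0, hB⟩ := exists_norm_qPoch_self_inv_le h2
  have key : ∀ m n e d, d ≤ e →
      ‖q ^ e / (qPoch q (q ^ 2) m * qPoch (q ^ 2) (q ^ 2) n)‖ ≤ ‖q‖ ^ d * (A * B) := by
    intro m n e d hd
    rw [div_eq_mul_inv, mul_inv, norm_mul, norm_mul, norm_pow]
    gcongr ?_ * (?_ * ?_)
    · exact pow_le_pow_of_le_one (norm_nonneg _) hq.le hd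
    · exact hA _
    · exact hB _
  refine ⟨A * B * 2, by positivity, fun m k n e d hd => ⟨?_, ?_⟩⟩
  · rw [norm_mul]
    calc _ ≤ ‖q‖ ^ d * (A * B) * 2 :=
          mul_le_mul (key _ _ _ _ hd) (norm_one_sub_pow_le hq k) (norm_nonneg _) (by positivity)
      _ = _ := by ring
  · have : 0 ≤ ‖q‖ ^ d * (A * B) := by positivity
    linarith [key m n e d hd]

theorem summable_slaterTerm {q : ℂ} (hq : ‖q‖ < 1) (m : ℕ) : Summable (slaterTerm q m) := by
  obtain ⟨C, -, hC⟩ := exists_norm_slaterTerm_le hq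
  refine summable_of_norm_le_geometric (norm_nonneg q) hq fun n => (hC _ 0 _ _ _ ?_).2
  have := Nat.le_self_pow two_ne_zero n
  omega

/-- The series to be evaluated. -/
noncomputable def slaterSum (q : ℂ) (m : ℕ) : ℂ := ∑' n, slaterTerm q m n

theorem slaterSum_eq {q : ℂ} (hq : ‖q‖ < 1) (m : ℕ) :
    slaterSum q m = slaterSum q (m + 1) + (q ^ 4) ^ (m + 1) * slaterSum q (m + 2) := by
  refine tsum_eq_of_telescoping
    -- Over the common denominator `(q;q²)_{m+n+1} (q²;q²)_n`, the difference of the terms at `m`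
    -- and `m + 1` has factor `(1 - q^{2n}) - q^{2m+2n+1}`; its first part is `E n`.
    (E := fun n => q ^ (n ^ 2 + 2 * m * n) /
      (qPoch q (q ^ 2) (m + n + 1) * qPoch (q ^ 2) (q ^ 2) n) * (1 - q ^ (2 * n)))
    ?_ ?_ (summable_slaterTerm hq _) (summable_slaterTerm hq _) ?_
  · intro n
    have h0 := qPoch_self_ne_zero (norm_pow_lt_one hq two_ne_zero) n
    have h1 := one_sub_pow_ne_zero (norm_pow_lt_one hq two_ne_zero) n.succ_ne_zero
    have h2 := qPoch_ne_zero (one_sub_mul_sq_pow_ne_zero hq) (m + n)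
    have h3 := one_sub_mul_sq_pow_ne_zero hq (m + n)
    have h4 := one_sub_mul_sq_pow_ne_zero hq (m + n + 1)
    simp only [slaterTerm]
    rw [show m + (n + 1) + 1 = m + n + 1 + 1 by ring, show m + 1 + n = m + n + 1 by ring,
      show m + 2 + n = m + n + 1 + 1 by ring]
    simp only [qPoch_succ _ _ (m + n + 1), qPoch_succ _ _ (m + n), qPoch_self_succ _ n]
    rw [Nat.succ_eq_add_one] at h1
    field_simp
    ring
  · simp
  · obtain ⟨C, -, hC⟩ := exists_norm_slaterTerm_le hq
    refine summable_of_norm_le_geometric (norm_nonneg q) hq fun n => (hC _ _ _ _ _ ?_).1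
    have := Nat.le_self_pow two_ne_zero n
    omega

theorem tendsto_slaterSum {q : ℂ} (hq : ‖q‖ < 1) :
    Tendsto (slaterSum q) atTop (𝓝 (qPochInf q (q ^ 2))⁻¹) := by
  obtain ⟨C, hC0, hC⟩ := exists_norm_slaterTerm_le hq
  have h2 := norm_pow_lt_one hq two_ne_zero
  have hlim := tendsto_tsum_of_dominated_convergence (𝓕 := (atTop : Filter ℕ))
    (f := slaterTerm q)
    (g := fun n => if n = 0 then (qPochInf q (q ^ 2))⁻¹ else 0) (bound := fun n => C * ‖q‖ ^ n)
    ((summable_geometric_of_lt_one (norm_nonneg q) hq).mul_left C) ?_ ?_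
  · rw [tsum_ite_eq] at hlim
    exact hlim
  · intro n
    rcases Nat.eq_zero_or_pos n with rfl | hn
    · have := (tendsto_qPoch q h2).inv₀ (qPochInf_ne_zero h2 (one_sub_mul_sq_pow_ne_zero hq))
      simpa [slaterTerm, qPoch_zero] using this
    · rw [if_neg hn.ne']
      refine squeeze_zero_norm (a := fun m => C * ‖q‖ ^ m) (fun m => (hC _ 0 _ _ _ ?_).2) ?_
      · nlinarith [Nat.zero_le (n ^ 2)]
      · simpa using (tendsto_pow_atTop_nhds_zero_of_lt_one (norm_nonneg q) hq).const_mul C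
  · refine Eventually.of_forall fun m n => (hC _ 0 _ _ _ ?_).2
    have := Nat.le_self_pow two_ne_zero n
    omega

theorem slaterSum_eq_selbergV {q : ℂ} (hq : ‖q‖ < 1) (m : ℕ) :
    slaterSum q m =
      qPochInf (-q) (q ^ 2) / qPochInf (q ^ 2) (q ^ 2) * selbergV (q ^ 4) m := by
  have h2 := norm_pow_lt_one hq two_ne_zero
  have h4 := norm_pow_lt_one hq four_ne_zero
  have n1 := qPochInf_ne_zero h2 (one_sub_mul_sq_pow_ne_zero hq)
  have n2 := qPochInf_self_ne_zero h2
  have n3 := qPochInf_self_ne_zero h4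
  have e := qPochInf_sq hq
  have hlim := (tendsto_slaterSum hq).sub ((tendsto_selbergV h4).const_mul
    (qPochInf (-q) (q ^ 2) / qPochInf (q ^ 2) (q ^ 2)))
  -- The constant is the ratio of the two limits, by the dissection `qPochInf_sq`.
  have hz : (qPochInf q (q ^ 2))⁻¹ -
      qPochInf (-q) (q ^ 2) / qPochInf (q ^ 2) (q ^ 2) * qPochInf (q ^ 4) (q ^ 4) = 0 := by
    field_simp
    rw [e]
    ring
  rw [hz] at hlim
  refine sub_eq_zero.mp (eq_zero_of_recurrence_of_tendsto_zero h4 (fun k => ?_) hlim m)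
  linear_combination slaterSum_eq hq k -
    qPochInf (-q) (q ^ 2) / qPochInf (q ^ 2) (q ^ 2) * selbergV_eq h4 k

/-! ### The q-binomial theorem and Jacobi's triple product -/

/-- The Gaussian binomial coefficient `[i + j, j]`, as a symmetric function of `i` and `j`. -/
noncomputable def qBinom (q : ℂ) (i j : ℕ) : ℂ :=
  qPoch q q (i + j) / (qPoch q q i * qPoch q q j)

theorem q_binomial_theorem {p : ℂ} (hp : ‖p‖ < 1) (x : ℂ) (M : ℕ) :
    ∏ k ∈ Finset.range M, (1 + x * p ^ k) =
      ∑ ij ∈ Finset.HasAntidiagonal.antidiagonal M, p ^ (ij.2.choose 2) * qBinom p ij.1 ij.2 * x ^ ij.2 := by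
  induction M with
  | zero => simp [qBinom, qPoch]
  | succ M ih =>
    -- Both Pascal rules at once, from `1 - p^{i+j} = (1 - p^i) + p^i (1 - p^j)`; each part vanishes
    -- at one end of the antidiagonal.
    have split : ∀ ij ∈ Finset.HasAntidiagonal.antidiagonal (M + 1),
        p ^ (ij.2.choose 2) * qBinom p ij.1 ij.2 * x ^ ij.2 =
          p ^ (ij.2.choose 2) * qBinom p ij.1 ij.2 * x ^ ij.2 *
            ((1 - p ^ ij.1) / (1 - p ^ (ij.1 + ij.2))) +
          p ^ (ij.2.choose 2) * qBinom p ij.1 ij.2 * x ^ ij.2 *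
            (p ^ ij.1 * (1 - p ^ ij.2) / (1 - p ^ (ij.1 + ij.2))) := by
      intro ij hij
      have h : ij.1 + ij.2 ≠ 0 := by rw [Finset.HasAntidiagonal.mem_antidiagonal.mp hij]; omega
      have h1 := one_sub_pow_ne_zero hp h
      rw [← mul_add, ← add_div, pow_add, show 1 - p ^ ij.1 + p ^ ij.1 * (1 - p ^ ij.2) =
        1 - p ^ ij.1 * p ^ ij.2 by ring, div_self (by rwa [← pow_add]), mul_one]
    rw [Finset.sum_congr rfl split, Finset.sum_add_distrib, Finset.Nat.sum_antidiagonal_succ,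
      Finset.Nat.sum_antidiagonal_succ', Finset.prod_range_succ, ih]
    simp only [pow_zero, sub_self, zero_div, mul_zero, zero_add]
    rw [← Finset.sum_add_distrib, Finset.sum_mul]
    refine Finset.sum_congr rfl fun ij hij => ?_
    obtain ⟨i, j⟩ := ij
    have h := Finset.HasAntidiagonal.mem_antidiagonal.mp hij
    simp only at h ⊢
    subst h
    have h1 := one_sub_pow_ne_zero hp (i + j).succ_ne_zero
    have h2 := one_sub_pow_ne_zero hp i.succ_ne_zero
    have h3 := one_sub_pow_ne_zero hp j.succ_ne_zero
    have h4 := qPoch_self_ne_zero hp i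
    have h5 := qPoch_self_ne_zero hp j
    have h6 : (j + 1).choose 2 = j.choose 2 + j := by
      rw [Nat.choose_succ_succ' j 1, Nat.choose_one_right, add_comm]
    simp only [Nat.succ_eq_add_one] at h1 h2 h3
    simp only [qBinom, h6]
    rw [show i + 1 + j = i + j + 1 by ring, show i + (j + 1) = i + j + 1 by ring,
      qPoch_self_succ, qPoch_self_succ, qPoch_self_succ]
    field_simp
    ring

theorem two_mul_choose_two (n : ℕ) : 2 * (n + 1).choose 2 = n ^ 2 + n := by
  induction n with
  | zero => simp
  | succ n ih =>
    rw [choose_two_succ, mul_add, ih]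
    ring

theorem two_mul_choose_two' (n : ℕ) : 2 * n.choose 2 + n = n ^ 2 := by
  cases n with
  | zero => simp
  | succ n =>
    rw [two_mul_choose_two]
    ring

/-- Of the `2N` factors, the last `N` give `(z;p)_N`; the first `N`, reversed and cleared of
negative powers of `p`, give `(p/z;p)_N`. -/
theorem qPoch_mul_qPoch_div {p z : ℂ} (hp0 : p ≠ 0) (hz : z ≠ 0) (N : ℕ) :
    (-z) ^ N * (qPoch z p N * qPoch (p / z) p N) =
      p ^ ((N + 1).choose 2) * ∏ k ∈ Finset.range (N + N), (1 + -z / p ^ N * p ^ k) := by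
  rw [Finset.prod_range_add]
  have h1 : ∏ k ∈ Finset.range N, (1 + -z / p ^ N * p ^ (N + k)) = qPoch z p N := by
    refine Finset.prod_congr rfl fun k _ => ?_
    rw [pow_add]
    field_simp
    ring
  have h2 : p ^ ((N + 1).choose 2) * ∏ k ∈ Finset.range N, (1 + -z / p ^ N * p ^ k) =
      (-z) ^ N * qPoch (p / z) p N := by
    have h3 : p ^ ((N + 1).choose 2) = ∏ k ∈ Finset.range N, p ^ (k + 1) := by
      clear h1
      induction N with
      | zero => simp
      | succ N ih => rw [choose_two_succ, pow_add, ih, Finset.prod_range_succ]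
    have h4 : (-z) ^ N = ∏ _k ∈ Finset.range N, -z := by simp
    rw [h3, ← Finset.prod_range_reflect (fun k => 1 + -z / p ^ N * p ^ k), qPoch, h4,
      ← Finset.prod_mul_distrib, ← Finset.prod_mul_distrib]
    refine Finset.prod_congr rfl fun k hk => ?_
    obtain ⟨r, rfl⟩ := Nat.exists_eq_add_of_lt (Finset.mem_range.mp hk)
    rw [show k + r + 1 - 1 - k = r by omega]
    field_simp
    ring
  rw [h1]
  linear_combination (-qPoch z p N) * h2

/-- A finite form of Jacobi's triple product identity. -/
theorem finite_jacobi_triple_product {p z : ℂ} (hp : ‖p‖ < 1) (hp0 : p ≠ 0) (hz : z ≠ 0) (N : ℕ) :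
    qPoch z p N * qPoch (p / z) p N =
      ∑ n ∈ Finset.range (N + 1),
        (-1) ^ n * p ^ ((n + 1).choose 2) * z⁻¹ ^ n * qBinom p (N + n) (N - n) -
      ∑ n ∈ Finset.range N,
        (-1) ^ n * p ^ ((n + 1).choose 2) * z ^ (n + 1) * qBinom p (N - (1 + n)) (N + n + 1) := by
  have hzN : (-z) ^ N ≠ 0 := pow_ne_zero _ (neg_ne_zero.mpr hz)
  refine mul_left_cancel₀ hzN ?_
  rw [qPoch_mul_qPoch_div hp0 hz, q_binomial_theorem hp,
    Finset.Nat.sum_antidiagonal_eq_sum_range_succ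
      (fun i j => p ^ (j.choose 2) * qBinom p i j * (-z / p ^ N) ^ j), Nat.succ_eq_add_one,
    add_assoc N N 1, Finset.sum_range_add, mul_add, ← Finset.sum_range_reflect, add_comm,
    mul_sub, sub_eq_add_neg]
  -- The expansion is cut in the middle: exponents `j = N - n` yield `z⁻¹ ^ n`, exponents `j = N + n
  -- + 1` yield `z ^ (n + 1)`.
  congr 1
  · rw [Finset.mul_sum, Finset.mul_sum]
    refine Finset.sum_congr rfl fun n hn => ?_
    obtain ⟨r, rfl⟩ := Nat.exists_eq_add_of_le (Nat.lt_succ_iff.mp (Finset.mem_range.mp hn))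
    rw [show n + r + (n + r) - (n + r + n) = r by omega, show n + r - n = r by omega]
    have e : (n + r + 1).choose 2 + r.choose 2 = (n + 1).choose 2 + (n + r) * r := by
      have h1 := two_mul_choose_two (n + r)
      have h2 := two_mul_choose_two n
      have h3 := two_mul_choose_two' r
      nlinarith
    have e' : p ^ ((n + r + 1).choose 2) * p ^ (r.choose 2) =
        p ^ ((n + 1).choose 2) * (p ^ (n + r)) ^ r := by
      rw [← pow_add, e, pow_add, pow_mul]
    have hpn : (p ^ (n + r)) ^ r ≠ 0 := pow_ne_zero _ (pow_ne_zero _ hp0)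
    rw [div_pow, inv_pow, pow_add (-z), neg_pow z n]
    have hs : ((-1 : ℂ) ^ n) * (-1) ^ n = 1 := by rw [← mul_pow]; simp
    have hzn : z ^ n ≠ 0 := pow_ne_zero _ hz
    field_simp
    linear_combination (-z) ^ r * qBinom p (n + r + n) r * e' -
      (-z) ^ r * qBinom p (n + r + n) r * p ^ ((n + 1).choose 2) * (p ^ (n + r)) ^ r * hs
  · rw [Finset.mul_sum, Finset.mul_sum, ← Finset.sum_neg_distrib]
    refine Finset.sum_congr rfl fun n hn => ?_
    obtain ⟨r, rfl⟩ := Nat.exists_eq_add_of_lt (Finset.mem_range.mp hn)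
    rw [show n + r + 1 - 1 - n = r by omega, show n + r + 1 - (1 + n) = r by omega,
      show n + r + 1 + (n + r + 1) - r = n + r + 1 + n + 1 by omega]
    have e : (n + r + 1 + 1).choose 2 + (n + r + 1 + n + 1).choose 2 =
        (n + 1).choose 2 + (n + r + 1) * (n + r + 1 + n + 1) := by
      have h1 := two_mul_choose_two (n + r + 1)
      have h2 := two_mul_choose_two n
      have h3 := two_mul_choose_two (n + r + 1 + n)
      nlinarith
    have e' : p ^ ((n + r + 1 + 1).choose 2) * p ^ ((n + r + 1 + n + 1).choose 2) =
        p ^ ((n + 1).choose 2) * (p ^ (n + r + 1)) ^ (n + r + 1 + n + 1) := by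
      rw [← pow_add, e, pow_add, pow_mul]
    have hpn : (p ^ (n + r + 1)) ^ (n + r + 1 + n + 1) ≠ 0 := pow_ne_zero _ (pow_ne_zero _ hp0)
    rw [div_pow, show (-z) ^ (n + r + 1 + n + 1) = (-z) ^ (n + r + 1) * (-((-1) ^ n * z ^ (n + 1)))
      by rw [add_assoc (n + r + 1), pow_add, neg_pow z (n + 1)]; ring]
    field_simp
    linear_combination (-qBinom p r (n + r + 1 + n + 1)) * e'

theorem tendsto_qBinom {p : ℂ} (hp : ‖p‖ < 1) {a b : ℕ → ℕ} (ha : Tendsto a atTop atTop)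
    (hb : Tendsto b atTop atTop) :
    Tendsto (fun N => qBinom p (a N) (b N)) atTop (𝓝 (qPochInf p p)⁻¹) := by
  have h := tendsto_qPoch p hp
  have h0 := qPochInf_self_ne_zero hp
  have := (h.comp (ha.atTop_add_atTop hb)).div ((h.comp ha).mul (h.comp hb)) (mul_ne_zero h0 h0)
  rwa [div_mul_cancel_left₀ h0] at this

theorem exists_norm_qBinom_le {p : ℂ} (hp : ‖p‖ < 1) :
    ∃ C : ℝ, 0 < C ∧ ∀ i j, ‖qBinom p i j‖ ≤ C := by
  obtain ⟨A, hA0, hA⟩ := exists_norm_qPoch_le p hp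
  obtain ⟨B, hB0, hB⟩ := exists_norm_qPoch_self_inv_le hp
  refine ⟨A * (B * B), by positivity, fun i j => ?_⟩
  rw [qBinom, div_eq_mul_inv, mul_inv, norm_mul, norm_mul]
  gcongr ?_ * (?_ * ?_)
  · exact hA _
  · exact hB _
  · exact hB _

/-- Tannery's theorem, used to let `N → ∞` in the finite triple product. -/
theorem tendsto_sum_range_mul {c : ℕ → ℂ} (hc : Summable fun n => ‖c n‖) {F : ℕ → ℕ → ℂ} {C : ℝ}
    (hF : ∀ N n, ‖F N n‖ ≤ C) {l : ℂ} (hl : ∀ n, Tendsto (F · n) atTop (𝓝 l)) {s : ℕ → ℕ}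
    (hs : Tendsto s atTop atTop) :
    Tendsto (fun N => ∑ n ∈ Finset.range (s N), c n * F N n) atTop (𝓝 ((∑' n, c n) * l)) := by
  have h := tendsto_tsum_of_dominated_convergence (𝓕 := (atTop : Filter ℕ))
    (f := fun N n => if n ∈ Finset.range (s N) then c n * F N n else 0) (g := fun n => c n * l)
    (bound := fun n => ‖c n‖ * C) (hc.mul_right C) ?_ ?_
  · rw [tsum_mul_right] at h
    refine h.congr fun N => ?_
    rw [tsum_eq_sum (s := Finset.range (s N)) fun n hn => if_neg hn]
    exact Finset.sum_congr rfl fun n hn => if_pos hn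
  · intro n
    refine ((hl n).const_mul (c n)).congr' ?_
    filter_upwards [hs.eventually_gt_atTop n] with N hN
    rw [if_pos (Finset.mem_range.mpr hN)]
  · refine Eventually.of_forall fun N n => ?_
    split_ifs
    · rw [norm_mul]
      exact mul_le_mul_of_nonneg_left (hF N n) (norm_nonneg _)
    · rw [norm_zero]
      exact mul_nonneg (norm_nonneg _) ((norm_nonneg _).trans (hF N n))

theorem summable_norm_pow_choose_mul_pow {p w : ℂ} (hp : ‖p‖ < 1) (hp0 : p ≠ 0) (hw : w ≠ 0) :
    Summable fun n : ℕ => ‖(-1) ^ n * p ^ ((n + 1).choose 2) * w ^ n‖ := by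
  have hne : ∀ n : ℕ, (-1) ^ n * p ^ ((n + 1).choose 2) * w ^ n ≠ 0 := fun n =>
    mul_ne_zero (mul_ne_zero (pow_ne_zero _ (by norm_num)) (pow_ne_zero _ hp0)) (pow_ne_zero _ hw)
  refine summable_of_ratio_test_tendsto_lt_one (l := 0) one_pos
    (Eventually.of_forall fun n => norm_ne_zero_iff.mpr (hne n)) ?_
  have h : Tendsto (fun n : ℕ => ‖p‖ ^ (n + 1) * ‖w‖) atTop (𝓝 0) := by
    have := ((tendsto_pow_atTop_nhds_zero_of_lt_one (norm_nonneg p) hp).comp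
      (tendsto_add_atTop_nat 1)).mul_const ‖w‖
    simpa using this
  refine h.congr fun n => ?_
  rw [norm_norm, norm_norm, ← norm_div, choose_two_succ, ← norm_pow, ← norm_mul,
    ← norm_neg (p ^ (n + 1) * w)]
  congr 1
  rw [eq_div_iff (hne n)]
  ring

/-- Jacobi's triple product identity. -/
theorem jacobi_triple_product {p z : ℂ} (hp : ‖p‖ < 1) (hp0 : p ≠ 0) (hz : z ≠ 0) :
    qPochInf₃ z (p / z) p p =
      ∑' n : ℕ, (-1) ^ n * p ^ ((n + 1).choose 2) * (z⁻¹ ^ n - z ^ (n + 1)) := by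
  obtain ⟨C, -, hC⟩ := exists_norm_qBinom_le hp
  have h0 := qPochInf_self_ne_zero hp
  have s1 := summable_norm_pow_choose_mul_pow hp hp0 (inv_ne_zero hz)
  have s2 : Summable fun n : ℕ => ‖(-1) ^ n * p ^ ((n + 1).choose 2) * z ^ (n + 1)‖ := by
    have := (summable_norm_pow_choose_mul_pow hp hp0 hz).mul_right ‖z‖
    refine this.congr fun n => ?_
    rw [← norm_mul, pow_succ z, mul_assoc _ (z ^ n)]
  have l1 := tendsto_sum_range_mul s1 (F := fun N n => qBinom p (N + n) (N - n))
    (fun _ _ => hC _ _) (fun n => tendsto_qBinom hp (tendsto_add_atTop_nat n)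
      (tendsto_sub_atTop_nat n)) (tendsto_add_atTop_nat 1)
  have l2 := tendsto_sum_range_mul s2 (F := fun N n => qBinom p (N - (1 + n)) (N + n + 1))
    (fun _ _ => hC _ _) (fun n => tendsto_qBinom hp (tendsto_sub_atTop_nat (1 + n))
      (tendsto_add_atTop_nat (n + 1))) tendsto_id
  have l3 := (tendsto_qPoch z hp).mul (tendsto_qPoch (p / z) hp)
  have e := tendsto_nhds_unique l3
    ((l1.sub l2).congr fun N => (finite_jacobi_triple_product hp hp0 hz N).symm)
  rw [qPochInf₃, e, ← sub_mul, inv_mul_cancel_right₀ h0, ← s1.of_norm.tsum_sub s2.of_norm]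
  exact tsum_congr fun n => by ring

/-- At `m = 0` the factorials cancel, leaving the theta series with `p = Q^5`, `z = Q^2`. -/
theorem selbergV_zero {Q : ℂ} (hQ : ‖Q‖ < 1) (hQ0 : Q ≠ 0) :
    selbergV Q 0 = qPochInf₃ (Q ^ 2) (Q ^ 3) (Q ^ 5) (Q ^ 5) := by
  have h := jacobi_triple_product (norm_pow_lt_one hQ (n := 5) (by norm_num)) (pow_ne_zero 5 hQ0)
    (pow_ne_zero 2 hQ0)
  rw [show Q ^ 5 / Q ^ 2 = Q ^ 3 by field_simp] at h
  rw [h, selbergV]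
  refine tsum_congr fun n => ?_
  have h0 := qPoch_self_ne_zero hQ n
  have e : 5 * (n + 1).choose 2 = (n + 1).choose 2 + 2 * n ^ 2 + 2 * n := by
    have := two_mul_choose_two n
    omega
  rw [selbergTerm, Nat.zero_add n, div_self h0, ← pow_mul Q 5, e, inv_pow]
  field_simp
  ring

theorem selbergV_one {Q : ℂ} (hQ : ‖Q‖ < 1) (hQ0 : Q ≠ 0) :
    selbergV Q 1 = qPochInf₃ Q (Q ^ 4) (Q ^ 5) (Q ^ 5) := by
  have h := jacobi_triple_product (norm_pow_lt_one hQ (n := 5) (by norm_num)) (pow_ne_zero 5 hQ0) hQ0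
  rw [show Q ^ 5 / Q = Q ^ 4 by field_simp] at h
  rw [h, ← selbergW_eq hQ 0, selbergW]
  refine tsum_congr fun n => ?_
  have h0 := qPoch_self_ne_zero hQ n
  have e : 5 * (n + 1).choose 2 = (n + 1).choose 2 + 2 * n ^ 2 + n + n := by
    have := two_mul_choose_two n
    omega
  rw [selbergTerm, Nat.zero_add n, div_self h0, ← pow_mul Q 5, e, inv_pow]
  field_simp
  ring

/-! ### Alternating convolutions of Gaussian binomials -/

theorem qBinom_zero_right {p : ℂ} (hp : ‖p‖ < 1) (N : ℕ) : qBinom p N 0 = 1 := by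
  simp [qBinom, qPoch_zero, qPoch_self_ne_zero hp N]

theorem qBinom_zero_left {p : ℂ} (hp : ‖p‖ < 1) (N : ℕ) : qBinom p 0 N = 1 := by
  simp [qBinom, qPoch_zero, qPoch_self_ne_zero hp N]

theorem qBinom_succ_succ {p : ℂ} (hp : ‖p‖ < 1) (N j : ℕ) :
    qBinom p (N + 1) (j + 1) = qBinom p N (j + 1) + p ^ (N + 1) * qBinom p (N + 1) j := by
  have h1 := one_sub_pow_ne_zero hp N.succ_ne_zero
  have h2 := one_sub_pow_ne_zero hp j.succ_ne_zero
  have h3 := qPoch_self_ne_zero hp N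
  have h4 := qPoch_self_ne_zero hp j
  simp only [Nat.succ_eq_add_one] at h1 h2
  simp only [qBinom]
  rw [show N + 1 + (j + 1) = N + j + 1 + 1 by ring, show N + (j + 1) = N + j + 1 by ring,
    show N + 1 + j = N + j + 1 by ring]
  simp only [qPoch_self_succ]
  field_simp
  ring

/-- The alternating self-convolution of `[N + j, j]`. -/
noncomputable def altConv (p : ℂ) (N n : ℕ) : ℂ :=
  ∑ j ∈ Finset.range (n + 1), (-1) ^ j * qBinom p N j * qBinom p N (n - j)

open PowerSeries in
theorem mk_altConv (p : ℂ) (N : ℕ) :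
    mk (altConv p N) = mk (fun j => (-1) ^ j * qBinom p N j) * mk (qBinom p N) := by
  ext n
  rw [coeff_mk, coeff_mul, Finset.Nat.sum_antidiagonal_eq_sum_range_succ_mk]
  simp [altConv]

open PowerSeries in
-- The series of `qBinom p N` is `1/(x;p)_{N+1}`, so passing from `N + 1` to `N` removes the factors
-- `1 ∓ p^{N+1} x` of the two denominators.
theorem one_sub_mul_mk_altConv {p : ℂ} (hp : ‖p‖ < 1) (N : ℕ) :
    (1 - C ((p ^ (N + 1)) ^ 2) * X ^ 2) * PowerSeries.mk (altConv p (N + 1)) = PowerSeries.mk (altConv p N) := by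
  have h1 : (1 - C (p ^ (N + 1)) * X) * PowerSeries.mk (qBinom p (N + 1)) = PowerSeries.mk (qBinom p N) := by
    ext n
    rw [sub_mul, one_mul, mul_assoc, map_sub, coeff_C_mul]
    cases n with
    | zero => simp [qBinom_zero_right hp]
    | succ n =>
      rw [coeff_succ_X_mul, coeff_mk, coeff_mk, coeff_mk, qBinom_succ_succ hp]
      ring
  have h2 : (1 + C (p ^ (N + 1)) * X) * PowerSeries.mk (fun j => (-1) ^ j * qBinom p (N + 1) j) =
      PowerSeries.mk (fun j => (-1) ^ j * qBinom p N j) := by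
    ext n
    rw [add_mul, one_mul, mul_assoc, map_add, coeff_C_mul]
    cases n with
    | zero => simp [qBinom_zero_right hp]
    | succ n =>
      rw [coeff_succ_X_mul, coeff_mk, coeff_mk, coeff_mk, qBinom_succ_succ hp]
      ring
  rw [mk_altConv, mk_altConv, ← h1, ← h2, map_pow]
  ring

theorem altConv_succ {p : ℂ} (hp : ‖p‖ < 1) (N n : ℕ) :
    altConv p (N + 1) (n + 2) = altConv p N (n + 2) + (p ^ (N + 1)) ^ 2 * altConv p (N + 1) n := by
  have h := congrArg (PowerSeries.coeff (n + 2)) (one_sub_mul_mk_altConv hp N)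
  rw [sub_mul, one_mul, mul_assoc, map_sub, PowerSeries.coeff_C_mul, PowerSeries.coeff_X_pow_mul,
    PowerSeries.coeff_mk, PowerSeries.coeff_mk, PowerSeries.coeff_mk] at h
  linear_combination h

theorem altConv_zero_right {p : ℂ} (hp : ‖p‖ < 1) (N : ℕ) : altConv p N 0 = 1 := by
  simp [altConv, qBinom_zero_right hp]

theorem altConv_one_right {p : ℂ} (hp : ‖p‖ < 1) (N : ℕ) : altConv p N 1 = 0 := by
  simp [altConv, Finset.sum_range_succ, qBinom_zero_right hp]

theorem altConv_zero_left_add_two {p : ℂ} (hp : ‖p‖ < 1) (n : ℕ) :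
    altConv p 0 (n + 2) = altConv p 0 n := by
  simp only [altConv, qBinom_zero_left hp, mul_one]
  rw [show n + 2 + 1 = n + 1 + 1 + 1 by ring, Finset.sum_range_succ, Finset.sum_range_succ]
  ring

/-- The weighted sums underlying both families of polynomials. -/
noncomputable def altConvSum (w : ℕ → ℂ) (p : ℂ) (M : ℕ) : ℂ :=
  ∑ n ∈ Finset.range (M + 1), w n * altConv p (M - n) n

theorem altConvSum_zero (w : ℕ → ℂ) {p : ℂ} (hp : ‖p‖ < 1) : altConvSum w p 0 = w 0 := by
  simp [altConvSum, altConv_zero_right hp]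

theorem altConvSum_one (w : ℕ → ℂ) {p : ℂ} (hp : ‖p‖ < 1) : altConvSum w p 1 = w 0 := by
  simp [altConvSum, Finset.sum_range_succ, altConv_zero_right hp, altConv_one_right hp]

/-- Along the diagonal `N + n = M`, the `p^{2i}` from the weight and the `p^{2(M-i)}` from
`altConv_succ` multiply to `p^{2M}`, independent of `i`. -/
theorem altConvSum_add_two {w : ℕ → ℂ} {p κ : ℂ} (hp : ‖p‖ < 1)
    (hw : ∀ i, w (i + 2) = κ * p ^ (2 * i) * w i) (M : ℕ) :
    altConvSum w p (M + 2) = altConvSum w p (M + 1) + κ * p ^ (2 * M) * altConvSum w p M := by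
  simp only [altConvSum]
  have split (f : ℕ → ℂ) (K : ℕ) : ∑ i ∈ Finset.range (K + 2), f i =
      ∑ i ∈ Finset.range K, f (i + 1 + 1) + f 1 + f 0 := by
    rw [Finset.sum_range_succ', Finset.sum_range_succ']
  rw [show M + 2 + 1 = M + 1 + 2 by ring, split _ (M + 1), show M + 1 + 1 = M + 2 by ring,
    split _ M, Finset.sum_range_succ, Finset.sum_range_succ _ M]
  simp only [altConv_zero_right hp, altConv_one_right hp, Nat.sub_self]
  have key : ∑ i ∈ Finset.range M, w (i + 1 + 1) * altConv p (M + 2 - (i + 1 + 1)) (i + 1 + 1) =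
      ∑ i ∈ Finset.range M, w (i + 1 + 1) * altConv p (M + 1 - (i + 1 + 1)) (i + 1 + 1) +
        κ * p ^ (2 * M) * ∑ i ∈ Finset.range M, w i * altConv p (M - i) i := by
    rw [Finset.mul_sum, ← Finset.sum_add_distrib]
    refine Finset.sum_congr rfl fun i hi => ?_
    obtain ⟨r, rfl⟩ := Nat.exists_eq_add_of_lt (Finset.mem_range.mp hi)
    rw [show i + r + 1 + 2 - (i + 1 + 1) = r + 1 by omega,
      show i + r + 1 + 1 - (i + 1 + 1) = r by omega, show i + r + 1 - i = r + 1 by omega,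
      add_assoc i 1 1, altConv_succ hp, hw]
    ring
  -- The top term has `N = 0`, where `altConv_succ` does not apply; the coefficients of `1/(1 - x²)`
  -- have period two.
  rw [key, show M + 1 + 1 = M + 2 by ring, altConv_zero_left_add_two hp, hw]
  ring

/-! ### The polynomials `a_m` and `b_m` -/

theorem gaussPoly_add_right (p : ℂ) (N j : ℕ) :
    gaussPoly p ((N : ℤ) + j) j = qBinom p N j := by
  rw [gaussPoly, if_pos ⟨by omega, by omega⟩, add_sub_cancel_right, Int.toNat_natCast,
    Int.toNat_natCast, ← Nat.cast_add, Int.toNat_natCast, qBinom, mul_comm (qPoch p p j)]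

theorem sum_gaussPoly_mul_gaussPoly (w : ℕ → ℂ) (p : ℂ) {M K : ℕ} (hK : M + 1 ≤ K) :
    ∑ n ∈ Finset.range K, ∑ j ∈ Finset.range K,
      w n * (-1) ^ j * gaussPoly p ((M : ℤ) - n + j) j * gaussPoly p ((M : ℤ) - j) ((n : ℤ) - j) =
    altConvSum w p M := by
  rw [altConvSum]
  symm
  refine Finset.sum_subset_zero_on_sdiff (Finset.range_mono hK) (fun n hn => ?_) (fun n hn => ?_)
  · refine Finset.sum_eq_zero fun j _ => ?_
    have : ¬ n < M + 1 := fun h => (Finset.mem_sdiff.mp hn).2 (Finset.mem_range.mpr h)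
    rw [mul_assoc, gaussPoly_mul_eq_zero _ _ _ _ (by omega), mul_zero]
  · have hnM := Finset.mem_range.mp hn
    rw [altConv, Finset.mul_sum]
    refine Finset.sum_subset_zero_on_sdiff (Finset.range_mono (by omega)) (fun j hj => ?_)
      (fun j hj => ?_)
    · have : ¬ j < n + 1 := fun h => (Finset.mem_sdiff.mp hj).2 (Finset.mem_range.mpr h)
      rw [mul_assoc, gaussPoly_mul_eq_zero _ _ _ _ (by omega), mul_zero]
    · have hjn := Finset.mem_range.mp hj
      have e1 := gaussPoly_add_right p (M - n) j
      have e2 := gaussPoly_add_right p (M - n) (n - j)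
      rw [show ((M - n : ℕ) : ℤ) = (M : ℤ) - n by omega] at e1 e2
      rw [show ((n - j : ℕ) : ℤ) = (n : ℤ) - j by omega,
        show (M : ℤ) - n + ((n : ℤ) - j) = M - j by ring] at e2
      rw [e1, e2]
      ring

theorem aPoly_succ (M : ℕ) (q : ℂ) :
    aPoly (M + 1) q = altConvSum (fun n => q ^ (n ^ 2)) (q ^ 2) M := by
  rw [aPoly, if_neg M.succ_ne_zero, ← sum_gaussPoly_mul_gaussPoly _ _ le_rfl]
  simp only [Nat.cast_add, Nat.cast_one, add_sub_cancel_right]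

theorem bPoly_add_two (M : ℕ) (q : ℂ) :
    bPoly (M + 2) q = altConvSum (fun n => q ^ (n ^ 2 + 2 * n)) (q ^ 2) M := by
  rw [bPoly, if_neg (by omega), ← sum_gaussPoly_mul_gaussPoly _ _ (Nat.le_succ (M + 1))]
  simp only [Nat.cast_add, Nat.cast_ofNat, add_sub_cancel_right, Nat.succ_eq_add_one, add_assoc,
    Nat.reduceAdd]

theorem aPoly_zero (q : ℂ) : aPoly 0 q = 0 := if_pos rfl

theorem bPoly_zero (q : ℂ) : bPoly 0 q = 1 := if_pos rfl

theorem bPoly_one (q : ℂ) : bPoly 1 q = 0 := by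
  rw [bPoly, if_neg one_ne_zero]
  refine Finset.sum_eq_zero fun n _ => Finset.sum_eq_zero fun j _ => ?_
  rw [mul_assoc, gaussPoly_mul_eq_zero _ _ _ _ (by omega), mul_zero]

theorem aPoly_one {q : ℂ} (hq : ‖q‖ < 1) : aPoly 1 q = 1 := by
  rw [aPoly_succ, altConvSum_zero _ (norm_pow_lt_one hq two_ne_zero)]
  simp

theorem aPoly_recurrence {q : ℂ} (hq : ‖q‖ < 1) (m : ℕ) :
    aPoly (m + 2) q = aPoly (m + 1) q + (q ^ 4) ^ m * aPoly m q := by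
  have h2 := norm_pow_lt_one hq two_ne_zero
  cases m with
  | zero =>
    rw [aPoly_zero, zero_add, aPoly_one hq, aPoly_succ, altConvSum_one _ h2]
    simp
  | succ m =>
    rw [aPoly_succ, aPoly_succ, aPoly_succ, altConvSum_add_two (κ := q ^ 4) h2 fun i => by ring]
    ring

theorem bPoly_recurrence {q : ℂ} (hq : ‖q‖ < 1) (m : ℕ) :
    bPoly (m + 2) q = bPoly (m + 1) q + (q ^ 4) ^ m * bPoly m q := by
  have h2 := norm_pow_lt_one hq two_ne_zero
  -- `b_0` and `b_1` lie outside the convolution formula, so two cases precede the generic one.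
  match m with
  | 0 =>
    rw [bPoly_zero, zero_add, bPoly_one, bPoly_add_two, altConvSum_zero _ h2]
    simp
  | 1 =>
    rw [bPoly_one, bPoly_add_two, altConvSum_one _ h2,
      bPoly_add_two 0, altConvSum_zero _ h2]
    simp
  | m + 2 =>
    rw [bPoly_add_two, bPoly_add_two m, show m + 2 + 1 = m + 1 + 2 by ring, bPoly_add_two,
      altConvSum_add_two (κ := q ^ 8) h2 fun i => by ring]
    ring

/-! ### Assembling the evaluation -/

theorem pow_mul_slaterSum_eq {q : ℂ} (hq : ‖q‖ < 1) (hq0 : q ≠ 0) (m : ℕ) :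
    q ^ (4 * m.choose 2) * slaterSum q m =
      (-1) ^ (m + 1) * (qPochInf (-q) (q ^ 2) / qPochInf (q ^ 2) (q ^ 2)) *
        (aPoly m q * qPochInf₃ (q ^ 4) (q ^ 16) (q ^ 20) (q ^ 20) -
          bPoly m q * qPochInf₃ (q ^ 8) (q ^ 12) (q ^ 20) (q ^ 20)) := by
  have h4 := norm_pow_lt_one hq four_ne_zero
  have hq4 := pow_ne_zero 4 hq0
  induction m using Nat.twoStepInduction with
  | zero =>
    rw [slaterSum_eq_selbergV hq, selbergV_zero h4 hq4, aPoly_zero, bPoly_zero]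
    simp only [← pow_mul, Nat.reduceMul]
    simp
  | one =>
    rw [slaterSum_eq_selbergV hq, selbergV_one h4 hq4, aPoly_one hq, bPoly_one]
    simp only [← pow_mul, Nat.reduceMul]
    simp
  | more m ih1 ih2 =>
    have e : (m + 1).choose 2 = m.choose 2 + m := by
      rw [Nat.choose_succ_succ' m 1, Nat.choose_one_right, add_comm]
    rw [aPoly_recurrence hq, bPoly_recurrence hq, show m + 2 = m + 1 + 1 from rfl,
      choose_two_succ, e]
    rw [e] at ih2
    -- The recurrence at `m` is multiplied by `q^{4 C(m,2) + 4m}`, matching `C(m+2,2) = C(m,2) + 2m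
    -- + 1`.
    linear_combination (q ^ 4) ^ m * ih1 - ih2 -
      q ^ (4 * m.choose 2) * (q ^ 4) ^ m * slaterSum_eq hq m

theorem corollary3p3 (m : ℕ) (q : ℂ) (hq : ‖q‖ < 1) (hq0 : 2 ≤ m → q ≠ 0) :
    HasSum
      (fun n : ℕ => q ^ (n ^ 2 + 2 * m * n) / (qPoch q (q ^ 2) (m + n) * qPoch (q ^ 2) (q ^ 2) n))
      ((-1) ^ ((m : ℤ) - 1) * qPochInf (-q) (q ^ 2) /
          (q ^ (2 * (m : ℤ) * ((m : ℤ) - 1)) * qPochInf (q ^ 2) (q ^ 2)) *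
        (aPoly m q * qPochInf₃ (q ^ 4) (q ^ 16) (q ^ 20) (q ^ 20) -
          bPoly m q * qPochInf₃ (q ^ 8) (q ^ 12) (q ^ 20) (q ^ 20))) := by
  have hsign : (-1 : ℂ) ^ ((m : ℤ) - 1) = (-1) ^ (m + 1) := by
    rw [show (m : ℤ) - 1 = ((m + 1 : ℕ) : ℤ) - 2 by push_cast; ring,
      zpow_sub₀ (by norm_num), zpow_natCast]
    norm_num
  have hexp : 2 * (m : ℤ) * ((m : ℤ) - 1) = ((4 * m.choose 2 : ℕ) : ℤ) := by
    have := two_mul_choose_two' m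
    zify at this
    push_cast
    linear_combination -2 * this
  rw [hsign, hexp, zpow_natCast]
  change HasSum (slaterTerm q m) _
  -- The triple product needs `q ≠ 0`; at `q = 0` only `m = 0, 1` occur and the series is its term
  -- `n = 0`.
  rcases eq_or_ne q 0 with rfl | hne
  · have hm : m < 2 := by
      by_contra h
      exact hq0 (not_lt.mp h) rfl
    have hinf : qPochInf 0 0 = 1 := by simp [qPochInf]
    have ha : aPoly 1 0 = 1 := aPoly_one (by simp)
    have hp : ∀ n, qPoch 0 0 n = 1 := fun n => by simp [qPoch]
    have hsum : HasSum (slaterTerm 0 m) (slaterTerm 0 m 0) :=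
      hasSum_single 0 fun n hn => by simp [slaterTerm, hn]
    convert hsum using 1
    interval_cases m
    · simp [slaterTerm, aPoly_zero, bPoly_zero, qPochInf₃, hinf, hp]
    · simp [slaterTerm, ha, bPoly_one, qPochInf₃, hinf, hp]
  · convert (summable_slaterTerm hq m).hasSum using 1
    have hpow : q ^ (4 * m.choose 2) ≠ 0 := pow_ne_zero _ hne
    refine mul_left_cancel₀ hpow ?_
    refine Eq.trans ?_ (pow_mul_slaterSum_eq hq hne m).symm
    field_simp
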